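/- Let $G$ be a finite simple bipartite graph whose vertex set is partitioned into two parts $U$ and $W$ such that every edge joins $U$ to $W$, every vertex of $U$ has degree $d_v$ and every vertex of $W$ has degree $d_c$. Suppose that $G$ contains a cycle and that its girth $g$ (the length of a shortest cycle) is at least $6$. Let $N_k$ be the number of cycles of length $k$ in $G$, counted as subgraphs, i.e. irrespective of starting vertex and direction. Let $\Psi_k$ be the number of closed walks $v_1,v_2,\dots,v_{k+1}=v_1$ of length $k$ in $G$ that are not cycles but for which the subgraph formed by the traversed edges contains a cycle; here closed walks that differ in starting vertex or direction are counted separately. Then $$ \begin{aligned} \frac{\Psi_{g+4}}{2(g+4)} ={}& N_{g+2}\Big[\tfrac{g+2}{2}(d_v+d_c)-(g+2)\Big]\\ &+N_g\Big[\tfrac g2(d_v-2)(d_c-1)+\tfrac g2(d_c-2)(d_v-1)\Big]\\ &+N_g\Big(\Big[\tbinom{g/2}{2}+\tfrac g2\Big](d_v-2)^2+\Big[\tbinom{g/2}{2}+\tfrac g2\Big](d_c-2)^2+\big(\tfrac g2\big)^2(d_v-2)(d_c-2)\Big)\\ &+N_g\Big(\tbinom g2+2g+(g+2)\big(\tfrac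 g2(d_v-2)+\tfrac g2(d_c-2)\big)\Big). \end{aligned} $$ -/

import Mathlib

namespace SimpleGraph

variable {V : Type*} (G : SimpleGraph V)

/-- A closed walk with cycle: it is not itself a cycle, but the graph formed by the edges it
traverses contains a cycle. (Vertices of `V` not on the walk are isolated in `fromEdgeSet`, so they
do not affect the existence of a cycle.) -/
def Walk.IsClosedWalkWithCycle {G : SimpleGraph V} {v : V} (p : G.Walk v v) : Prop :=
  ¬ p.IsCycle ∧ ¬ (SimpleGraph.fromEdgeSet p.edgeSet).IsAcyclic

/-- The number `N_k` of cycles of length `k`, as subgraphs: a cycle is identified with its set of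
edges, so that starting vertex and direction are disregarded. -/
noncomputable def numCycles (k : ℕ) : ℕ :=
  Set.ncard {S : Set (Sym2 V) |
    ∃ (v : V) (c : G.Walk v v), c.IsCycle ∧ c.length = k ∧ S = c.edgeSet}

/-- The number `Ψ_k` of closed walks with cycle of length `k`; closed walks that differ in starting
vertex or direction are counted separately. -/
noncomputable def numClosedWalksWithCycle (k : ℕ) : ℕ :=
  Set.ncard {w : Σ v : V, G.Walk v v | w.2.length = k ∧ w.2.IsClosedWalkWithCycle}

/-- `G` is bipartite with parts `U` and `W` that partition the vertex set, every vertex of `U` has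
degree `dv` and every vertex of `W` has degree `dc`. -/
structure IsBiregularWith [G.LocallyFinite] (U W : Set V) (dv dc : ℕ) : Prop where
  isBipartiteWith : G.IsBipartiteWith U W
  union_eq_univ : U ∪ W = Set.univ
  degree_left : ∀ u ∈ U, G.degree u = dv
  degree_right : ∀ w ∈ W, G.degree w = dc

end SimpleGraph

/-! Cancelling backtracks turns every closed walk into a unique reduced one. For lengths below `2g`
the traversed edges contain a cycle exactly when this reduction is nontrivial
(`Walk.isAcyclic_fromEdgeSet_edgeSet_iff`). Since `g + 4 < 2g`, $\Psi_{g+4}$ counts the closed walks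
with nontrivial reduction, minus the cycles of length `g + 4`. By parity the reduction has length
`g`, `g + 2` or `g + 4`.

The number of walks with a prescribed reduction depends only on its length and on the two degrees,
as if the walk were lifted to the biregular universal cover; `IsBiregularWith.card_reduce_eq` gives
it as `treeWalkCount`.

It remains to count the reduced closed walks themselves. Below length `2g`, such a walk is a cycle
if its first and last edges differ; otherwise it is a step attached to a shorter reduced closed walk
at a neighbour. With $T_U(n)$ the number starting in $U$, this yields $T_U(n+2) = (n+2)N_{n+2} +
(d_c-1)T_W(n) - nN_n$ and $T_U(g) = gN_g$. The factor $n$ is the number of oriented cycles from $U$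
per cycle. Adding the counts for starts in $U$ and in $W$ gives the formula; the $N_{g+4}$ terms
cancel. -/

namespace SimpleGraph

open Finset

/-! ### Reduced walks and cancellation of backtracking. -/

namespace Walk

variable {V : Type*} {G : SimpleGraph V} {u v w : V}

/-- A walk is reduced if it never backtracks, that is, if consecutive edges are distinct. -/
def IsReduced (p : G.Walk u v) : Prop := p.edges.IsChain (· ≠ ·)

@[simp] lemma isReduced_nil : (nil : G.Walk u u).IsReduced := by simp [IsReduced]

lemma IsReduced.of_cons {h : G.Adj u w} {p : G.Walk w v} (hp : (cons h p).IsReduced) :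
    p.IsReduced := by
  simpa [IsReduced] using List.IsChain.tail hp

lemma isReduced_cons_iff {h : G.Adj u w} {p : G.Walk w v} :
    (cons h p).IsReduced ↔ p.IsReduced ∧ (p.Nil ∨ p.snd ≠ u) := by
  cases p with
  | nil => simp [IsReduced]
  | @cons _ x _ h' q =>
    have : s(u, w) = s(w, x) ↔ x = u := by
      simp only [Sym2.eq_iff]
      exact ⟨fun H => H.elim (fun H => absurd H.1 h.ne) (fun H => H.1.symm),
        fun H => Or.inr ⟨H.symm, trivial⟩⟩
    simp [IsReduced, List.isChain_cons_cons, this, and_comm]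

lemma IsTrail.isReduced {p : G.Walk u v} (hp : p.IsTrail) : p.IsReduced :=
  List.Pairwise.isChain hp.edges_nodup

lemma eq_cons_of_snd_eq (h : G.Adj u w) {p : G.Walk w v} (hn : ¬ p.Nil) (hs : p.snd = u) :
    ∃ q : G.Walk u v, p = cons h.symm q := by
  cases p with
  | nil => simp at hn
  | cons h' q =>
    simp only [snd_cons] at hs
    subst hs
    exact ⟨q, rfl⟩

section Reduction

variable [DecidableEq V]

/-- Prepend a step to a walk, cancelling it against the first step of the walk if that would
backtrack. -/
def push (h : G.Adj u w) : G.Walk w v → G.Walk u v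
  | nil => cons h nil
  | @cons _ _ _ x _ h' q => if hx : x = u then q.copy hx rfl else cons h (cons h' q)

/-- The reduced walk obtained from a walk by cancelling all backtracking steps. -/
def reduce : {u v : V} → G.Walk u v → G.Walk u v
  | _, _, nil => nil
  | _, _, cons h p => push h (reduce p)

lemma push_of_nil_or_ne (h : G.Adj u w) {p : G.Walk w v} (hp : p.Nil ∨ p.snd ≠ u) :
    push h p = cons h p := by
  cases p with
  | nil => rfl
  | @cons _ x _ h' q =>
    have : x ≠ u := by simpa using hp
    simp [push, this]

lemma push_cons_symm (h : G.Adj u w) (q : G.Walk u v) : push h (cons h.symm q) = q := by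
  simp [push]

lemma push_cases (h : G.Adj u w) (p : G.Walk w v) :
    ((p.Nil ∨ p.snd ≠ u) ∧ push h p = cons h p) ∨
      ∃ q : G.Walk u v, p = cons h.symm q ∧ push h p = q := by
  by_cases hp : p.Nil ∨ p.snd ≠ u
  · exact Or.inl ⟨hp, push_of_nil_or_ne h hp⟩
  · push Not at hp
    obtain ⟨q, rfl⟩ := eq_cons_of_snd_eq h hp.1 hp.2
    exact Or.inr ⟨q, rfl, push_cons_symm h q⟩

lemma IsReduced.push (h : G.Adj u w) {p : G.Walk w v} (hp : p.IsReduced) :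
    (push h p).IsReduced := by
  obtain ⟨h1, h2⟩ | ⟨q, rfl, h2⟩ := push_cases h p
  · rw [h2, isReduced_cons_iff]
    exact ⟨hp, h1⟩
  · rw [h2]
    exact hp.of_cons

lemma isReduced_reduce : ∀ {u v : V} (p : G.Walk u v), p.reduce.IsReduced
  | _, _, nil => by simp [reduce]
  | _, _, cons h p => (isReduced_reduce p).push h

/-- On reduced walks, pushing a step and pushing its reverse are mutually inverse, as in the action
of a free groupoid. Hence `push_eq_iff`, which transports the condition "the reduction is `r`"
across the first step in the count of walks by reduction. -/
lemma IsReduced.push_symm_push (h : G.Adj u w) {p : G.Walk w v} (hp : p.IsReduced) :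
    Walk.push h.symm (Walk.push h p) = p := by
  obtain ⟨-, h2⟩ | ⟨q, rfl, h2⟩ := push_cases h p
  · rw [h2]
    exact push_cons_symm h.symm p
  · rw [h2]
    exact push_of_nil_or_ne _ (isReduced_cons_iff.1 hp).2

lemma IsReduced.push_eq_iff (h : G.Adj u w) {p : G.Walk w v} {r : G.Walk u v}
    (hp : p.IsReduced) (hr : r.IsReduced) : Walk.push h p = r ↔ p = Walk.push h.symm r :=
  ⟨fun H => by rw [← H, hp.push_symm_push], fun H => by rw [H]; exact hr.push_symm_push h.symm⟩

lemma IsReduced.reduce_eq : ∀ {u v : V} {p : G.Walk u v}, p.IsReduced → p.reduce = p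
  | _, _, nil, _ => rfl
  | _, _, cons h p, hp => by
    rw [reduce, hp.of_cons.reduce_eq]
    exact push_of_nil_or_ne h (isReduced_cons_iff.1 hp).2

lemma length_push (h : G.Adj u w) (p : G.Walk w v) :
    (push h p).length = if ¬ p.Nil ∧ p.snd = u then p.length - 1 else p.length + 1 := by
  obtain ⟨h1, h2⟩ | ⟨q, rfl, h2⟩ := push_cases h p
  · rw [h2, if_neg (by tauto), length_cons]
  · simp [h2]

lemma length_reduce_le : ∀ {u v : V} (p : G.Walk u v), p.reduce.length ≤ p.length
  | _, _, nil => le_rfl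
  | _, _, cons h p => by
    have := length_reduce_le p
    rw [reduce, length_push, length_cons]
    split_ifs <;> omega

lemma edges_push_subset (h : G.Adj u w) (p : G.Walk w v) :
    (push h p).edges ⊆ s(u, w) :: p.edges := by
  obtain ⟨-, h2⟩ | ⟨q, rfl, h2⟩ := push_cases h p
  · simp [h2]
  · rw [h2, edges_cons]
    exact List.subset_cons_of_subset _ (List.subset_cons_self _ _)

lemma edges_reduce_subset : ∀ {u v : V} (p : G.Walk u v), p.reduce.edges ⊆ p.edges
  | _, _, nil => by simp [reduce]
  | _, _, cons h p => fun e he => by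
    have := edges_push_subset h _ he
    rw [List.mem_cons] at this
    rw [edges_cons, List.mem_cons]
    exact this.imp_right fun H => edges_reduce_subset p H

/-- A cancellation removes two traversals of the same edge, so parity survives. Consequently a
closed walk with trivial reduction traverses every edge an even number of times. -/
lemma even_count_edges_reduce (e : Sym2 V) : ∀ {u v : V} (p : G.Walk u v),
    Even (p.reduce.edges.count e) ↔ Even (p.edges.count e)
  | _, _, nil => by simp [reduce]
  | _, _, @cons _ _ u w v h p => by
    have ih := even_count_edges_reduce e p
    rw [reduce, edges_cons]
    obtain ⟨-, h2⟩ | ⟨q, h1, h2⟩ := push_cases h p.reduce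
    · rw [h2, edges_cons, List.count_cons, List.count_cons]
      split_ifs <;> simp [Nat.even_add_one, ih]
    · rw [h2, List.count_cons]
      rw [h1, edges_cons, List.count_cons, Sym2.eq_swap] at ih
      split_ifs at ih ⊢ with hh
      · rw [Nat.even_add_one, ← ih, Nat.even_add_one, not_not]
      · simpa using ih

end Reduction

end Walk

end SimpleGraph

/-! ### Reduced closed walks, cycles and the girth. -/

namespace SimpleGraph

open Finset

namespace Walk

variable {V : Type*} {G : SimpleGraph V} {u v w : V}

lemma IsReduced.of_append_left {p : G.Walk u v} {q : G.Walk v w} (h : (p.append q).IsReduced) :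
    p.IsReduced := by
  rw [IsReduced, edges_append] at h
  exact h.left_of_append

lemma IsReduced.of_append_right {p : G.Walk u v} {q : G.Walk v w} (h : (p.append q).IsReduced) :
    q.IsReduced := by
  rw [IsReduced, edges_append] at h
  exact h.right_of_append

/-- Prepending a step to a path closes a cycle at the first return to the starting vertex. -/
lemma IsReduced.isCycle_cons_takeUntil [DecidableEq V] {h : G.Adj u w} {p : G.Walk w v}
    (hr : (cons h p).IsReduced) (hp : p.IsPath) (hu : u ∈ p.support) :
    (cons h (p.takeUntil u hu)).IsCycle := by
  rw [cons_isCycle_iff]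
  refine ⟨hp.takeUntil hu, fun he => ?_⟩
  have h1 := (hp.takeUntil hu).eq_snd_of_mem_edges (Sym2.eq_swap ▸ he)
  rw [snd_takeUntil h.ne] at h1
  obtain h2 | h2 := (isReduced_cons_iff.1 hr).2
  · cases p with
    | nil => exact h.ne (by simpa using hu)
    | cons h' q => simp at h2
  · exact h2 h1.symm

/-- A reduced walk that is not a path contains a cycle as a contiguous piece. -/
lemma IsReduced.exists_isCycle_of_not_isPath : ∀ {u v : V} {p : G.Walk u v}, p.IsReduced →
    ¬ p.IsPath → ∃ (x : V) (a : G.Walk u x) (c : G.Walk x x) (b : G.Walk x v),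
      c.IsCycle ∧ p = a.append (c.append b)
  | _, _, nil, _, h => absurd IsPath.nil h
  | u, _, cons h p, hr, hnp => by
    classical
    by_cases hp : p.IsPath
    · have hu : u ∈ p.support := by
        by_contra hu
        exact hnp (hp.cons hu)
      refine ⟨u, nil, _, p.dropUntil u hu, hr.isCycle_cons_takeUntil hp hu, ?_⟩
      simp
    · obtain ⟨x, a, c, b, hc, rfl⟩ := hr.of_cons.exists_isCycle_of_not_isPath hp
      exact ⟨x, cons h a, c, b, hc, by simp⟩

/-- A closed path is trivial, so a nontrivial reduced closed walk is not a path and contains a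
cycle, though it need not be one. -/
lemma IsReduced.egirth_le_length {p : G.Walk v v} (hp : p.IsReduced) (hn : ¬ p.Nil) :
    G.egirth ≤ p.length := by
  obtain ⟨x, a, c, b, hc, rfl⟩ := hp.exists_isCycle_of_not_isPath
    (fun h => hn (isPath_iff_nil.1 h))
  refine (SimpleGraph.egirth_le_length hc).trans ?_
  simp only [length_append]
  exact_mod_cast (by omega : c.length ≤ a.length + (c.length + b.length))

lemma penultimate_append_of_not_nil (p : G.Walk u v) {q : G.Walk v w} (hq : ¬ q.Nil) :
    (p.append q).penultimate = q.penultimate := by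
  induction p with
  | nil => rfl
  | cons h p ih =>
    rw [cons_append, penultimate_cons_of_not_nil, ih hq]
    rw [nil_append_iff]
    exact fun H => hq H.2

lemma isReduced_append_iff {p : G.Walk u v} {q : G.Walk v w} :
    (p.append q).IsReduced ↔ p.IsReduced ∧ q.IsReduced ∧
      (p.Nil ∨ q.Nil ∨ q.snd ≠ p.penultimate) := by
  induction p with
  | nil => simp
  | @cons u x y h p ih =>
    rw [cons_append, isReduced_cons_iff, ih, isReduced_cons_iff]
    cases p with
    | nil => simp
    | cons h' p =>
      simp only [cons_append, snd_cons, not_nil_cons, penultimate_cons_cons]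
      tauto

/-- A reduced closed walk whose first and last edges differ and whose length is less than twice the
girth is a cycle. -/
lemma IsReduced.isCycle_of_length_lt {p : G.Walk v v} (hp : p.IsReduced) (hn : ¬ p.Nil)
    (hne : p.snd ≠ p.penultimate) (hlt : (p.length : ℕ∞) < 2 * G.egirth) : p.IsCycle := by
  classical
  cases p with
  | nil => simp at hn
  | @cons _ w _ h q =>
    by_cases hq : q.IsPath
    · have := hp.isCycle_cons_takeUntil hq q.end_mem_support
      have hd := (isPath_iff_nil.1 (hq.dropUntil q.end_mem_support)).eq_nil
      have hs := q.take_spec q.end_mem_support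
      rw [hd, append_nil] at hs
      rwa [hs] at this
    · exfalso
      obtain ⟨x, a, c, b, hc, rfl⟩ := hp.of_cons.exists_isCycle_of_not_isPath hq
      -- Excise the cycle `c` and read the remainder from `x` around through `v`. The only new
      -- junction is at `v`, where `hne` excludes a backtrack. This remainder and `c` each have
      -- length at least the girth, which contradicts `hlt`.
      have hred : (b.append (cons h a)).IsReduced := by
        refine isReduced_append_iff.2 ⟨hp.of_cons.of_append_right.of_append_right, ?_, ?_⟩
        · rw [← cons_append] at hp
          exact hp.of_append_left
        · by_cases hb : b.Nil
          · exact Or.inl hb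
          · refine Or.inr (Or.inr ?_)
            have hcb : ¬ (c.append b).Nil := fun H => hb (nil_append_iff.1 H).2
            rwa [← cons_append, penultimate_append_of_not_nil _ hcb,
              penultimate_append_of_not_nil _ hb, cons_append, snd_cons, ← snd_cons a h] at hne
      have h1 := SimpleGraph.egirth_le_length hc
      have h2 := hred.egirth_le_length (by simp)
      have : (((cons h (a.append (c.append b))).length : ℕ) : ℕ∞) =
          c.length + (b.append (cons h a)).length := by
        rw [← Nat.cast_add]
        congr 1
        simp only [length_append, length_cons]
        omega
      rw [this, two_mul] at hlt
      exact absurd (add_le_add h1 h2) (not_le.2 hlt)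

lemma IsReduced.isCycle_iff_snd_ne_penultimate {p : G.Walk v v} (hp : p.IsReduced)
    (hn : ¬ p.Nil) (hlt : (p.length : ℕ∞) < 2 * G.egirth) :
    p.IsCycle ↔ p.snd ≠ p.penultimate :=
  ⟨fun h => h.snd_ne_penultimate, fun h => hp.isCycle_of_length_lt hn h hlt⟩

lemma IsCycle.isReduced {p : G.Walk v v} (hp : p.IsCycle) : p.IsReduced :=
  hp.isTrail.isReduced

/-- Paths with the same endpoints are equal if the edges of one are among those of the other. -/
lemma IsPath.eq_of_edges_subset : ∀ {u v : V} {p q : G.Walk u v}, p.IsPath → q.IsPath →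
    q.edges ⊆ p.edges → q = p
  | _, _, .nil, q, _, hq, _ => (isPath_iff_nil.1 hq).eq_nil
  | u, v, @cons _ _ _ x _ h p, q, hp, hq, hs => by
    rw [cons_isPath_iff] at hp
    cases q with
    | nil => exact absurd p.end_mem_support hp.2
    | @cons _ y _ h' q =>
      rw [cons_isPath_iff] at hq
      have hx : s(u, y) = s(u, x) ∨ s(u, y) ∈ p.edges := by
        simpa only [edges_cons, List.mem_cons] using
          hs (show s(u, y) ∈ (cons h' q).edges from List.mem_cons_self ..)
      obtain hx | hx := hx
      · rw [Sym2.congr_right] at hx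
        subst hx
        congr 1
        refine hp.1.eq_of_edges_subset hq.1 fun e he => ?_
        have := hs (List.mem_cons_of_mem _ he)
        rw [edges_cons, List.mem_cons] at this
        refine this.resolve_left ?_
        rintro rfl
        exact hq.2 (q.fst_mem_support_of_mem_edges he)
      · exact absurd (p.fst_mem_support_of_mem_edges hx) hp.2

/-- Cycles with the same start and second vertex are equal if they have the same edges. -/
lemma IsCycle.eq_of_edgeSet_eq {p q : G.Walk v v} (hp : p.IsCycle) (hq : q.IsCycle)
    (hs : q.snd = p.snd) (he : q.edgeSet = p.edgeSet) : q = p := by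
  cases p with
  | nil => exact absurd hp not_isCycle_nil
  | cons h p =>
    cases q with
    | nil => exact absurd hq not_isCycle_nil
    | cons h' q =>
      simp only [snd_cons] at hs
      subst hs
      rw [cons_isCycle_iff] at hp hq
      congr 1
      refine hp.1.eq_of_edges_subset hq.1 fun e hmem => ?_
      have : e ∈ (cons h' q).edgeSet := List.mem_cons_of_mem _ hmem
      rw [he, mem_edgeSet, edges_cons, List.mem_cons] at this
      refine this.resolve_left ?_
      rintro rfl
      exact hq.2 hmem

/-- A cycle can be started with any of its edges, in either direction. -/
lemma IsCycle.exists_snd_eq_of_mem_edges {a b : V} {c : G.Walk v v} (hc : c.IsCycle)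
    (he : s(a, b) ∈ c.edges) : ∃ c' : G.Walk a a, c'.IsCycle ∧ c'.snd = b ∧
      c'.length = c.length ∧ c'.edgeSet = c.edgeSet := by
  classical
  have ha := c.fst_mem_support_of_mem_edges he
  have hr := (isCycle_rotate ha).2 hc
  have hE : (c.rotate a ha).edgeSet = c.edgeSet := by
    ext e
    exact (c.rotate_edges a ha).mem_iff
  have hb : b ∈ (c.rotate a ha).toSubgraph.neighborSet a := by
    rw [Subgraph.mem_neighborSet, ← Subgraph.mem_edgeSet, mem_edges_toSubgraph]
    exact (c.rotate_edges a ha).mem_iff.2 he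
  rw [hr.neighborSet_toSubgraph_endpoint] at hb
  obtain hb | hb := hb
  · exact ⟨_, hr, hb.symm, by simp, hE⟩
  · exact ⟨_, hr.reverse, by rw [snd_reverse, hb], by simp, by rw [edgeSet_reverse, hE]⟩

/-- The edges of a closed walk shorter than twice the girth form a forest if and only if the walk
reduces to the trivial walk. -/
lemma isAcyclic_fromEdgeSet_edgeSet_iff [DecidableEq V] {p : G.Walk v v}
    (hlt : (p.length : ℕ∞) < 2 * G.egirth) :
    (fromEdgeSet p.edgeSet).IsAcyclic ↔ p.reduce.Nil := by
  have hle : fromEdgeSet p.edgeSet ≤ G := by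
    intro a b hab
    exact p.adj_of_mem_edges ((fromEdgeSet_adj _).1 hab).1
  constructor
  · intro hac
    by_contra hn
    obtain ⟨x, a, c, b, hc, he⟩ := (isReduced_reduce p).exists_isCycle_of_not_isPath
      (fun h => hn (isPath_iff_nil.1 h))
    have hsub : ∀ e ∈ c.edges, e ∈ (fromEdgeSet p.edgeSet).edgeSet := by
      intro e hec
      rw [edgeSet_fromEdgeSet]
      refine ⟨edges_reduce_subset p ?_, G.not_isDiag_of_mem_edgeSet (c.edges_subset_edgeSet hec)⟩
      rw [he]
      simp [hec]
    exact hac _ (hc.transfer hsub)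
  · intro hn x c hc
    have hc' : (c.mapLe hle).IsCycle := (isCycle_mapLe hle).2 hc
    -- Each edge of the cycle is traversed by `p`, and an even number of times, hence at least
    -- twice. So `p` is at least twice as long as a cycle.
    have hsub : ((c.mapLe hle).edges ++ (c.mapLe hle).edges).Subperm p.edges := by
      rw [List.subperm_ext_iff]
      intro e he
      have hec : e ∈ (c.mapLe hle).edges := by simpa using he
      have hp : 0 < p.edges.count e := by
        rw [List.count_pos_iff]
        rw [edges_mapLe_eq_edges] at hec
        have := c.edges_subset_edgeSet hec
        rw [edgeSet_fromEdgeSet] at this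
        exact this.1
      have heven : Even (p.edges.count e) := by
        rw [← even_count_edges_reduce, hn.eq_nil]
        simp
      rw [List.count_append, List.count_eq_one_of_mem hc'.edges_nodup hec]
      obtain ⟨k, hk⟩ := heven
      omega
    have h1 := hsub.length_le
    rw [List.length_append, length_edges, length_edges] at h1
    have h2 := egirth_le_length hc'
    refine absurd hlt (not_lt.2 ?_)
    rw [two_mul]
    exact (add_le_add h2 h2).trans (by exact_mod_cast h1)

end Walk

end SimpleGraph

/-! ### Walk counts in the biregular tree. -/

namespace SimpleGraph

open Finset

/-- The number of walks of length `n` in a biregular tree between two vertices at distance `l`, where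
`a` is the degree of the starting vertex and `b` is the degree of its neighbours. -/
def treeWalkCount : ℚ → ℚ → ℕ → ℕ → ℚ
  | _, _, 0, 0 => 1
  | _, _, 0, _ + 1 => 0
  | a, b, n + 1, 0 => a * treeWalkCount b a n 1
  | a, b, n + 1, l + 1 => treeWalkCount b a n l + (a - 1) * treeWalkCount b a n (l + 2)

lemma treeWalkCount_of_lt {n l : ℕ} (h : n < l) (a b : ℚ) : treeWalkCount a b n l = 0 := by
  induction n generalizing l a b with
  | zero =>
    obtain ⟨l, rfl⟩ := Nat.exists_eq_succ_of_ne_zero h.ne'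
    rfl
  | succ n ih =>
    obtain ⟨l, rfl⟩ := Nat.exists_eq_succ_of_ne_zero (Nat.ne_zero_of_lt h)
    rw [treeWalkCount, ih (by omega), ih (by omega)]
    ring

lemma treeWalkCount_self (n : ℕ) (a b : ℚ) : treeWalkCount a b n n = 1 := by
  induction n generalizing a b with
  | zero => rfl
  | succ n ih => rw [treeWalkCount, ih, treeWalkCount_of_lt (by omega)]; ring

/-- Unfolding two steps at a time restores the order of `a` and `b`, so the induction runs over `k`.
The extra terms have length equal to distance and contribute 1 each, up to their coefficients. -/
lemma treeWalkCount_add_two (k : ℕ) (a b : ℚ) :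
    treeWalkCount a b (2 * k + 2) (2 * k) = a + k * (a + b - 2) := by
  induction k with
  | zero => simp [treeWalkCount]
  | succ k ih =>
    rw [show 2 * (k + 1) + 2 = 2 * k + 2 + 1 + 1 by ring, show 2 * (k + 1) = 2 * k + 1 + 1 by ring,
      treeWalkCount, treeWalkCount, ih, treeWalkCount_self, treeWalkCount_self]
    push_cast
    ring

/-- The same two-step induction; the extra terms now reduce to the values of
`treeWalkCount_add_two`, which are linear in `k`, whence the quadratic. -/
lemma treeWalkCount_add_four (k : ℕ) (a b : ℚ) :
    treeWalkCount a b (2 * k + 4) (2 * k) = a * (a + b - 1) +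
      k * ((b - 1) * a + (a - 1) * (a + b - 1)) + (k * (k + 1) / 2) * (a + b - 2) ^ 2 := by
  induction k with
  | zero =>
    rw [Nat.mul_zero, treeWalkCount, treeWalkCount, treeWalkCount_self]
    simp only [treeWalkCount]
    push_cast
    ring
  | succ k ih =>
    have h := treeWalkCount_add_two (k + 1) a b
    rw [show 2 * (k + 1) + 2 = 2 * k + 4 by ring, show 2 * (k + 1) = 2 * k + 2 by ring] at h
    rw [show 2 * (k + 1) + 4 = 2 * k + 4 + 1 + 1 by ring, show 2 * (k + 1) = 2 * k + 1 + 1 by ring,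
      treeWalkCount, treeWalkCount, ih, h, treeWalkCount, h, treeWalkCount_self]
    push_cast
    ring

variable {V : Type*} {G : SimpleGraph V}

lemma IsBiregularWith.symm [G.LocallyFinite] {U W : Set V} {dv dc : ℕ}
    (hG : G.IsBiregularWith U W dv dc) : G.IsBiregularWith W U dc dv where
  isBipartiteWith := hG.isBipartiteWith.symm
  union_eq_univ := by rw [Set.union_comm, hG.union_eq_univ]
  degree_left := hG.degree_right
  degree_right := hG.degree_left

variable [DecidableEq V]

section LocallyFinite

variable [G.LocallyFinite]

lemma card_filter_finsetWalkLength_succ (n : ℕ) (u v : V) (P : G.Walk u v → Prop)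
    [DecidablePred P] : #{p ∈ G.finsetWalkLength (n + 1) u v | P p} =
      ∑ w : G.neighborSet u, #{p ∈ G.finsetWalkLength n w v | P (.cons w.2 p)} := by
  rw [finsetWalkLength, filter_biUnion, card_biUnion]
  · refine sum_congr rfl fun w _ => ?_
    rw [filter_map, card_map]
    rfl
  · intro w _ w' _ hne
    refine Finset.disjoint_left.2 ?_
    simp only [mem_filter, mem_map]
    rintro p ⟨⟨q, -, rfl⟩, -⟩ ⟨⟨q', -, h⟩, -⟩
    have hs : (w' : V) = w := (Walk.snd_cons q' _).symm.trans
      ((congrArg Walk.snd h).trans (Walk.snd_cons q _))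
    exact hne (Subtype.ext hs.symm)

/-- In a biregular graph, the number of walks of length `n` with a given reduction. -/
theorem IsBiregularWith.card_reduce_eq {U W : Set V} {dv dc : ℕ}
    (hG : G.IsBiregularWith U W dv dc) (n : ℕ) {u v : V} (hu : u ∈ U) {r : G.Walk u v}
    (hr : r.IsReduced) :
    (#{p ∈ G.finsetWalkLength n u v | p.reduce = r} : ℚ) = treeWalkCount dv dc n r.length := by
  induction n generalizing U W dv dc u v with
  | zero =>
    cases r with
    | nil =>
      have : {p ∈ G.finsetWalkLength 0 u u | p.reduce = .nil} = {.nil} := by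
        ext p
        simp only [mem_filter, mem_finsetWalkLength_iff, mem_singleton]
        constructor
        · rintro ⟨h, -⟩
          exact (Walk.length_eq_zero_iff.1 h).eq_nil
        · rintro rfl
          exact ⟨rfl, rfl⟩
      rw [this]
      simp [treeWalkCount]
    | cons h r =>
      rw [Walk.length_cons, treeWalkCount, Nat.cast_eq_zero, card_eq_zero, filter_eq_empty_iff]
      intro p hp hpr
      have := p.length_reduce_le
      rw [hpr, mem_finsetWalkLength_iff.1 hp] at this
      simp at this
  | succ n ih =>
    rw [card_filter_finsetWalkLength_succ, Nat.cast_sum]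
    -- A walk with first step to `w` reduces to `r` exactly when its tail reduces to `r` with the
    -- reverse step pushed on. This lowers the length by 1 if `r` also begins with `w`, and raises
    -- it by 1 otherwise.
    have key : ∀ w : G.neighborSet u,
        (#{p ∈ G.finsetWalkLength n w v | (Walk.cons w.2 p).reduce = r} : ℚ) =
          treeWalkCount dc dv n (if ¬ r.Nil ∧ r.snd = w then r.length - 1 else r.length + 1) := by
      intro w
      rw [← Walk.length_push (Adj.symm w.2),
        ← ih hG.symm (hG.isBipartiteWith.mem_of_mem_adj hu w.2) (hr.push _)]
      congr 2
      refine filter_congr fun p _ => ?_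
      exact p.isReduced_reduce.push_eq_iff w.2 hr
    rw [sum_congr rfl fun w _ => key w]
    have hcard : (Fintype.card (G.neighborSet u) : ℚ) = dv := by
      rw [card_neighborSet_eq_degree, hG.degree_left u hu]
    cases r with
    | nil =>
      simp only [Walk.nil_nil, not_true_eq_false, false_and, if_false, Walk.length_nil, sum_const,
        card_univ, nsmul_eq_mul, hcard, treeWalkCount]
    | @cons _ x _ h r =>
      -- Only the second vertex `x` of `r` shortens the target; the value for all other neighbours
      -- is taken as a constant, with a correction at `x`.
      have : ∀ w : G.neighborSet u, treeWalkCount dc dv n (if ¬ (Walk.cons h r).Nil ∧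
          (Walk.cons h r).snd = w then (Walk.cons h r).length - 1 else
          (Walk.cons h r).length + 1) = treeWalkCount dc dv n (r.length + 2) +
            if w = ⟨x, h⟩ then treeWalkCount dc dv n r.length - treeWalkCount dc dv n (r.length + 2)
            else 0 := by
        intro w
        by_cases hw : w = ⟨x, h⟩
        · simp [hw]
        · have : x ≠ w := fun H => hw (Subtype.ext H.symm)
          simp [hw, this]
      rw [sum_congr rfl fun w _ => this w, sum_add_distrib, sum_ite_eq', sum_const, card_univ,
        nsmul_eq_mul, hcard, Walk.length_cons, treeWalkCount]
      simp only [mem_univ, if_true]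
      ring

end LocallyFinite

end SimpleGraph

/-! ### Reduced closed walks and cycles of a biregular graph, counted by starting part. -/

namespace SimpleGraph

open Finset

variable {V : Type*} {G : SimpleGraph V}

lemma IsBiregularWith.mem_right_iff [G.LocallyFinite] {U W : Set V} {dv dc : ℕ}
    (hG : G.IsBiregularWith U W dv dc) {v : V} : v ∈ W ↔ v ∉ U := by
  have h1 : v ∈ U ∪ W := hG.union_eq_univ ▸ Set.mem_univ v
  have h2 : v ∈ U → v ∉ W := fun h => Set.disjoint_left.1 hG.isBipartiteWith.disjoint h
  rw [Set.mem_union] at h1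
  tauto

lemma IsBiregularWith.even_length_iff [G.LocallyFinite] {U W : Set V} {dv dc : ℕ}
    (hG : G.IsBiregularWith U W dv dc) {u v : V} (p : G.Walk u v) (hu : u ∈ U) :
    Even p.length ↔ v ∈ U := by
  induction p generalizing U W dv dc with
  | nil => simp [hu]
  | cons h p ih =>
    rw [Walk.length_cons, Nat.even_add_one,
      ih hG.symm (hG.isBipartiteWith.mem_of_mem_adj hu h), hG.symm.mem_right_iff]

lemma IsBiregularWith.even_length [G.LocallyFinite] {U W : Set V} {dv dc : ℕ}
    (hG : G.IsBiregularWith U W dv dc) {v : V} (p : G.Walk v v) : Even p.length := by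
  by_cases hv : v ∈ U
  · exact (hG.even_length_iff p hv).2 hv
  · rw [← hG.mem_right_iff] at hv
    exact (hG.symm.even_length_iff p hv).2 hv

lemma Walk.snd_append_of_not_nil {u v w : V} {p : G.Walk u v} (hp : ¬ p.Nil) (q : G.Walk v w) :
    (p.append q).snd = p.snd := by
  cases p with
  | nil => simp at hp
  | cons h p => simp

lemma Walk.eq_concat_of_penultimate_eq {u v w : V} {p : G.Walk u v} (h : G.Adj w v)
    (hs : p.penultimate = w) : ∃ q : G.Walk u w, p = q.concat h := by
  subst hs
  exact ⟨p.dropLast, (concat_dropLast h).symm⟩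

lemma Walk.isReduced_cons_concat_iff {v w : V} {h : G.Adj v w} {q : G.Walk w w} (hq : ¬ q.Nil) :
    (Walk.cons h (q.concat h.symm)).IsReduced ↔
      q.IsReduced ∧ v ≠ q.snd ∧ v ≠ q.penultimate := by
  have hn : ¬ (q.append (cons h.symm nil)).Nil := fun H => hq (nil_append_iff.1 H).1
  rw [isReduced_cons_iff, concat_eq_append, isReduced_append_iff, snd_append_of_not_nil hq]
  simp only [hq, hn, isReduced_cons_iff, isReduced_nil, nil_nil, not_nil_cons, snd_cons, false_or,
    true_and, true_or]
  tauto

/-- Both sides run once over the edges, each oriented from `U` to `W`. This is what moves the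
attached step of a reduced closed walk from its start in `U` to the neighbour in `W`. -/
lemma IsBiregularWith.sum_sum_neighborFinset [Fintype V] [DecidableRel G.Adj] {M : Type*} [AddCommMonoid M]
    {U W : Set V} [DecidablePred (· ∈ U)] [DecidablePred (· ∈ W)]
    {dv dc : ℕ} (hG : G.IsBiregularWith U W dv dc) (f : V → V → M) :
    ∑ v with v ∈ U, ∑ w ∈ G.neighborFinset v, f v w =
      ∑ w with w ∈ W, ∑ v ∈ G.neighborFinset w, f v w := by
  refine sum_comm' fun v w => ?_
  simp only [mem_filter, mem_univ, true_and, mem_neighborFinset]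
  constructor
  · rintro ⟨hv, h⟩
    exact ⟨h.symm, hG.isBipartiteWith.mem_of_mem_adj hv h⟩
  · rintro ⟨h, hw⟩
    exact ⟨hG.isBipartiteWith.mem_of_mem_adj' hw h.symm, h.symm⟩

section Closed

variable [Fintype V] [DecidableEq V] [DecidableRel G.Adj]

open scoped Classical in
variable (G) in
/-- The reduced closed walks of length `n` at `v`. -/
noncomputable def reducedClosedWalks (n : ℕ) (v : V) : Finset (G.Walk v v) :=
  {p ∈ G.finsetWalkLength n v v | p.IsReduced}

open scoped Classical in
variable (G) in
/-- The cycles of length `n` at `v`. -/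
noncomputable def cyclesAt (n : ℕ) (v : V) : Finset (G.Walk v v) :=
  {p ∈ G.finsetWalkLength n v v | p.IsCycle}

open scoped Classical in
variable (G) in
/-- The number of reduced closed walks of length `n` that start in `U`. -/
noncomputable def numReducedClosedFrom (U : Set V) (n : ℕ) : ℕ :=
  ∑ v with v ∈ U, #(G.reducedClosedWalks n v)

open scoped Classical in
variable (G) in
/-- The number of cycles of length `n` that start in `U`, counted with direction. -/
noncomputable def numCyclesFrom (U : Set V) (n : ℕ) : ℕ :=
  ∑ v with v ∈ U, #(G.cyclesAt n v)

@[simp] lemma mem_reducedClosedWalks {n : ℕ} {v : V} {p : G.Walk v v} :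
    p ∈ G.reducedClosedWalks n v ↔ p.length = n ∧ p.IsReduced := by
  simp [reducedClosedWalks, mem_finsetWalkLength_iff]

@[simp] lemma mem_cyclesAt {n : ℕ} {v : V} {p : G.Walk v v} :
    p ∈ G.cyclesAt n v ↔ p.length = n ∧ p.IsCycle := by
  simp [cyclesAt, mem_finsetWalkLength_iff]

lemma IsBiregularWith.card_length_reduce_eq {U W : Set V} {dv dc : ℕ}
    (hG : G.IsBiregularWith U W dv dc) (n l : ℕ) {v : V} (hv : v ∈ U) :
    (#{p ∈ G.finsetWalkLength n v v | p.reduce.length = l} : ℚ) =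
      treeWalkCount dv dc n l * #(G.reducedClosedWalks l v) := by
  rw [card_eq_sum_card_fiberwise (f := Walk.reduce) (t := G.reducedClosedWalks l v)]
  · rw [Nat.cast_sum, mul_comm, ← nsmul_eq_mul, ← sum_const]
    refine sum_congr rfl fun r hr => ?_
    rw [mem_reducedClosedWalks] at hr
    rw [← hr.1, ← hG.card_reduce_eq n hv hr.2, filter_filter]
    congr 2
    refine filter_congr fun p _ => ?_
    exact ⟨fun h => h.2, fun h => ⟨h ▸ rfl, h⟩⟩
  · intro p hp
    simp only [coe_filter, Set.mem_ofPred_eq] at hp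
    simp [hp.2, Walk.isReduced_reduce]

/-- Reduced closed walks at `v` whose first and last edges agree arise from reduced closed walks at
a neighbour of `v`. -/
lemma card_reducedClosedWalks_snd_eq_penultimate (l : ℕ) (v : V) :
    #{p ∈ G.reducedClosedWalks (l + 3) v | p.snd = p.penultimate} =
      ∑ w ∈ G.neighborFinset v,
        #{q ∈ G.reducedClosedWalks (l + 1) w | v ≠ q.snd ∧ v ≠ q.penultimate} := by
  rw [← sum_attach, ← card_sigma]
  symm
  refine card_bij (fun x _ => .cons ((G.mem_neighborFinset _ _).1 x.1.2)
    (x.2.concat ((G.mem_neighborFinset _ _).1 x.1.2).symm)) ?_ ?_ ?_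
  · rintro ⟨⟨w, hw⟩, q⟩ hq
    simp only [mem_sigma, mem_filter, mem_reducedClosedWalks] at hq ⊢
    obtain ⟨-, ⟨hl, hr⟩, h1, h2⟩ := hq
    have hn : ¬ q.Nil := fun H => by rw [← Walk.length_eq_zero_iff] at H; omega
    refine ⟨⟨by simp [hl], (Walk.isReduced_cons_concat_iff hn).2 ⟨hr, h1, h2⟩⟩, ?_⟩
    rw [Walk.snd_cons, Walk.penultimate_cons_of_not_nil, Walk.penultimate_concat]
    rw [← Walk.length_eq_zero_iff]
    simp
  · rintro ⟨⟨w, hw⟩, q⟩ - ⟨⟨w', hw'⟩, q'⟩ - h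
    obtain rfl : w = w' := by simpa using congrArg Walk.snd h
    simp only [Walk.cons.injEq, heq_eq_eq, true_and] at h
    obtain ⟨_, h'⟩ := Walk.concat_inj h
    rw [Walk.copy_rfl_rfl] at h'
    rw [h']
  · intro p hp
    simp only [mem_filter, mem_reducedClosedWalks] at hp
    obtain ⟨⟨hl, hr⟩, hs⟩ := hp
    cases p with
    | nil => simp at hl
    | @cons _ w _ h p =>
      have hn : ¬ p.Nil := fun H => by
        rw [← Walk.length_eq_zero_iff] at H
        rw [Walk.length_cons] at hl
        omega
      rw [Walk.snd_cons, Walk.penultimate_cons_of_not_nil _ _ hn] at hs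
      obtain ⟨q, rfl⟩ := Walk.eq_concat_of_penultimate_eq h.symm hs.symm
      have hql : q.length = l + 1 := by simpa using hl
      have hqn : ¬ q.Nil := fun H => by rw [← Walk.length_eq_zero_iff] at H; omega
      refine ⟨⟨⟨w, (G.mem_neighborFinset _ _).2 h⟩, q⟩, ?_, rfl⟩
      simp only [mem_sigma, mem_attach, mem_filter, mem_reducedClosedWalks, true_and]
      have := (Walk.isReduced_cons_concat_iff hqn).1 hr
      exact ⟨⟨hql, this.1⟩, this.2⟩

/-- For a reduced closed walk at `w` with second vertex `a` and penultimate vertex `b`, this counts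
the steps that can be attached without backtracking: one fewer when `a` and `b` differ, which below
twice the girth means that the walk is a cycle. -/
lemma card_neighborFinset_filter_ne_ne {w a b : V} (ha : G.Adj w a) (hb : G.Adj w b) :
    (#{v ∈ G.neighborFinset w | v ≠ a ∧ v ≠ b} : ℚ) =
      G.degree w - 1 - if a ≠ b then 1 else 0 := by
  have h : {v ∈ G.neighborFinset w | v ≠ a ∧ v ≠ b} = ((G.neighborFinset w).erase a).erase b := by
    ext v
    simp only [mem_filter, mem_erase]
    tauto
  have ha' : a ∈ G.neighborFinset w := (G.mem_neighborFinset _ _).2 ha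
  rw [h]
  split_ifs with hab
  · rw [cast_card_erase_of_mem (mem_erase.2 ⟨hab.symm, (G.mem_neighborFinset _ _).2 hb⟩),
      cast_card_erase_of_mem ha', card_neighborFinset_eq_degree]
  · push Not at hab
    subst hab
    rw [erase_idem, cast_card_erase_of_mem ha', card_neighborFinset_eq_degree, sub_zero]

/-- Below twice the girth, a reduced closed walk is a cycle or is obtained by attaching a step to a
shorter reduced closed walk. -/
lemma IsBiregularWith.numReducedClosedFrom_add_three {U W : Set V} {dv dc : ℕ}
    (hG : G.IsBiregularWith U W dv dc) (l : ℕ) (hl : ((l + 3 : ℕ) : ℕ∞) < 2 * G.egirth) :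
    (G.numReducedClosedFrom U (l + 3) : ℚ) = G.numCyclesFrom U (l + 3) +
      ((dc - 1) * G.numReducedClosedFrom W (l + 1) - G.numCyclesFrom W (l + 1)) := by
  classical
  have hsplit : ∀ v, #(G.reducedClosedWalks (l + 3) v) = #(G.cyclesAt (l + 3) v) +
      #{p ∈ G.reducedClosedWalks (l + 3) v | p.snd = p.penultimate} := by
    intro v
    rw [← card_filter_add_card_filter_not (s := G.reducedClosedWalks (l + 3) v)
      (fun p => p.snd = p.penultimate), add_comm]
    congr 2
    ext p
    simp only [mem_filter, mem_reducedClosedWalks, mem_cyclesAt]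
    constructor
    · rintro ⟨⟨h1, h2⟩, h3⟩
      refine ⟨h1, h2.isCycle_of_length_lt (fun H => ?_) h3 (h1 ▸ hl)⟩
      rw [← Walk.length_eq_zero_iff] at H
      omega
    · rintro ⟨h1, h2⟩
      exact ⟨⟨h1, h2.isReduced⟩, h2.snd_ne_penultimate⟩
  -- Double counting of pairs `(v, q)`: a walk `q` admits `dc - 1` attachments, or `dc - 2` if it is
  -- a cycle; hence the subtracted number of cycles.
  have htail : ∀ w ∈ W, ∑ v ∈ G.neighborFinset w,
      (#{q ∈ G.reducedClosedWalks (l + 1) w | v ≠ q.snd ∧ v ≠ q.penultimate} : ℚ) =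
        (dc - 1) * #(G.reducedClosedWalks (l + 1) w) - #(G.cyclesAt (l + 1) w) := by
    intro w hw
    have h1 : ∀ q ∈ G.reducedClosedWalks (l + 1) w,
        (#{v ∈ G.neighborFinset w | v ≠ q.snd ∧ v ≠ q.penultimate} : ℚ) =
          (dc - 1) - if q.IsCycle then 1 else 0 := by
      intro q hq
      rw [mem_reducedClosedWalks] at hq
      have hn : ¬ q.Nil := fun H => by rw [← Walk.length_eq_zero_iff] at H; omega
      have hlt : (q.length : ℕ∞) < 2 * G.egirth :=
        lt_of_le_of_lt (by rw [hq.1]; exact_mod_cast (by omega : l + 1 ≤ l + 3)) hl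
      rw [card_neighborFinset_filter_ne_ne (Walk.adj_snd hn) (Walk.adj_penultimate hn).symm,
        hG.degree_right w hw]
      simp only [hq.2.isCycle_iff_snd_ne_penultimate hn hlt]
    have h2 : {q ∈ G.reducedClosedWalks (l + 1) w | q.IsCycle} = G.cyclesAt (l + 1) w := by
      ext q
      simp only [mem_filter, mem_reducedClosedWalks, mem_cyclesAt]
      exact ⟨fun h => ⟨h.1.1, h.2⟩, fun h => ⟨⟨h.1, h.2.isReduced⟩, h.2⟩⟩
    have h3 : ∑ v ∈ G.neighborFinset w,
        #{q ∈ G.reducedClosedWalks (l + 1) w | v ≠ q.snd ∧ v ≠ q.penultimate} =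
        ∑ q ∈ G.reducedClosedWalks (l + 1) w,
          #{v ∈ G.neighborFinset w | v ≠ q.snd ∧ v ≠ q.penultimate} :=
      sum_card_bipartiteAbove_eq_sum_card_bipartiteBelow
        (fun v (q : G.Walk w w) => v ≠ q.snd ∧ v ≠ q.penultimate)
    rw [← Nat.cast_sum, h3, Nat.cast_sum, sum_congr rfl h1, sum_sub_distrib, sum_const,
      nsmul_eq_mul, sum_boole, h2, mul_comm]
  have hsum : (∑ v with v ∈ U,
      #{p ∈ G.reducedClosedWalks (l + 3) v | p.snd = p.penultimate} : ℚ) =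
      (dc - 1) * G.numReducedClosedFrom W (l + 1) - G.numCyclesFrom W (l + 1) := by
    simp_rw [card_reducedClosedWalks_snd_eq_penultimate, Nat.cast_sum]
    rw [hG.sum_sum_neighborFinset, sum_congr rfl fun w hw => htail w (by simpa using hw),
      sum_sub_distrib, ← mul_sum, numReducedClosedFrom, numCyclesFrom]
    push_cast
    rfl
  rw [← hsum, numReducedClosedFrom, numCyclesFrom]
  simp_rw [hsplit]
  push_cast
  rw [sum_add_distrib]

lemma numReducedClosedFrom_eq_zero (U : Set V) {n : ℕ} (hn : 0 < n) (h : (n : ℕ∞) < G.egirth) :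
    G.numReducedClosedFrom U n = 0 := by
  refine sum_eq_zero fun v _ => ?_
  rw [card_eq_zero, eq_empty_iff_forall_notMem]
  intro p hp
  rw [mem_reducedClosedWalks] at hp
  have := hp.2.egirth_le_length (fun H => by rw [← Walk.length_eq_zero_iff] at H; omega)
  rw [hp.1] at this
  exact absurd h (not_lt.2 this)

/-- Every cycle of length `n` has exactly `n` orientations starting in a given part. -/
lemma IsBiregularWith.numCyclesFrom_eq {U W : Set V} {dv dc : ℕ}
    (hG : G.IsBiregularWith U W dv dc) (n : ℕ) :
    G.numCyclesFrom U n = n * G.numCycles n := by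
  classical
  rw [numCyclesFrom, ← card_sigma]
  have hadj : ∀ {a b : V}, G.Adj a b → a ∈ U → b ∉ U := fun h ha =>
    hG.mem_right_iff.1 (hG.isBipartiteWith.mem_of_mem_adj ha h)
  have hstart : ∀ {v : V} {c : G.Walk v v} {e : Sym2 V}, c.IsCycle → e ∈ c.edges →
      ∃ a, a ∈ U ∧ ∃ c' : G.Walk a a, c'.IsCycle ∧ s(a, c'.snd) = e ∧ c'.length = c.length ∧
        c'.edgeSet = c.edgeSet := by
    intro v c e hc he
    induction e with
    | _ a b =>
      by_cases ha : a ∈ U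
      · obtain ⟨c', h1, h2, h3⟩ := hc.exists_snd_eq_of_mem_edges he
        exact ⟨a, ha, c', h1, by rw [h2], h3⟩
      · have hb : b ∈ U := hG.isBipartiteWith.mem_of_mem_adj' (hG.mem_right_iff.2 ha)
          (c.adj_of_mem_edges he).symm
        rw [Sym2.eq_swap] at he ⊢
        obtain ⟨c', h1, h2, h3⟩ := hc.exists_snd_eq_of_mem_edges he
        exact ⟨b, hb, c', h1, by rw [h2], h3⟩
  set S := Finset.sigma {v | v ∈ U} fun v => G.cyclesAt n v with hS
  have hmem : ∀ x : Σ v, G.Walk v v, x ∈ S ↔ x.1 ∈ U ∧ x.2.length = n ∧ x.2.IsCycle := by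
    intro x
    simp [hS]
  have himage : ((S.image fun x => x.2.edges.toFinset).card : ℕ) = G.numCycles n := by
    rw [numCycles, ← Set.ncard_coe_finset, ← Set.ncard_image_of_injective _ coe_injective]
    congr 1
    ext E
    simp only [Set.mem_image, mem_coe, Finset.mem_image, Set.mem_ofPred_eq]
    constructor
    · rintro ⟨_, ⟨⟨v, c⟩, hx, rfl⟩, rfl⟩
      rw [hmem] at hx
      exact ⟨v, c, hx.2.2, hx.2.1, by ext; simp⟩
    · rintro ⟨v, c, hc, hl, rfl⟩
      obtain ⟨a, ha, c', h1, -, h3, h4⟩ := hstart hc (Walk.mk_start_snd_mem_edges hc.not_nil)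
      refine ⟨_, ⟨⟨a, c'⟩, (hmem _).2 ⟨ha, h3.trans hl, h1⟩, rfl⟩, ?_⟩
      rw [← h4]
      ext
      simp
  rw [card_eq_sum_card_image (fun x => x.2.edges.toFinset) S, ← himage, mul_comm, ← smul_eq_mul,
    ← sum_const]
  refine sum_congr rfl fun E hE => ?_
  obtain ⟨⟨v₀, c₀⟩, hx₀, rfl⟩ := Finset.mem_image.1 hE
  rw [hmem] at hx₀
  dsimp only at hx₀ ⊢
  have hcard : #c₀.edges.toFinset = n := by
    rw [List.toFinset_card_of_nodup hx₀.2.2.edges_nodup, Walk.length_edges, hx₀.2.1]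
  rw [← hcard]
  have hE' : ∀ {v} {c : G.Walk v v}, c.edges.toFinset = c₀.edges.toFinset ↔
      c.edgeSet = c₀.edgeSet := by
    intro v c
    simp [Finset.ext_iff, Set.ext_iff]
  -- For a fixed edge set, an oriented cycle from `U` is determined by its first edge: exactly one
  -- endpoint of that edge lies in `U`, which fixes both start and direction. Every edge of the
  -- cycle occurs, by `hstart`.
  refine card_bij (fun x _ => s(x.1, x.2.snd)) ?_ ?_ ?_
  · rintro ⟨v, c⟩ hx
    simp only [mem_filter, hmem] at hx
    rw [← hx.2, List.mem_toFinset]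
    exact Walk.mk_start_snd_mem_edges hx.1.2.2.not_nil
  · rintro ⟨v, c⟩ hx ⟨v', c'⟩ hx' h
    simp only [mem_filter, hmem, hE'] at hx hx'
    dsimp only at h
    rw [Sym2.eq_iff] at h
    obtain ⟨rfl, h⟩ | ⟨rfl, h⟩ := h
    · rw [hx'.1.2.2.eq_of_edgeSet_eq hx.1.2.2 h (hx.2.trans hx'.2.symm)]
    · exact absurd hx.1.1 (hadj (Walk.adj_snd hx'.1.2.2.not_nil) hx'.1.1)
  · intro e he
    rw [List.mem_toFinset] at he
    obtain ⟨a, ha, c', h1, h2, h3, h4⟩ := hstart hx₀.2.2 he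
    refine ⟨⟨a, c'⟩, ?_, h2⟩
    rw [mem_filter, hmem, hE']
    exact ⟨⟨ha, h3.trans hx₀.2.1, h1⟩, h4⟩

end Closed

end SimpleGraph

/-! ### Closed walks with cycle of length `g + 4`. -/

namespace SimpleGraph

open Finset

variable {V : Type*} {G : SimpleGraph V} [Fintype V] [DecidableEq V] [DecidableRel G.Adj]

open scoped Classical in
lemma numClosedWalksWithCycle_eq_sum (n : ℕ) : G.numClosedWalksWithCycle n =
    ∑ v, #{p ∈ G.finsetWalkLength n v v | p.IsClosedWalkWithCycle} := by
  rw [← card_sigma, ← Set.ncard_coe_finset, numClosedWalksWithCycle]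
  congr 1
  ext x
  simp [mem_finsetWalkLength_iff]

open scoped Classical in
/-- Closed walks with cycle of length `g + 4` at a vertex, sorted by the length of their
reduction. -/
lemma IsBiregularWith.card_isClosedWalkWithCycle {U W : Set V} {dv dc g : ℕ}
    (hG : G.IsBiregularWith U W dv dc) (hgirth : G.egirth = g) (hg : 6 ≤ g) (heven : Even g)
    {v : V} (hv : v ∈ U) :
    (#{p ∈ G.finsetWalkLength (g + 4) v v | p.IsClosedWalkWithCycle} : ℚ) =
      treeWalkCount dv dc (g + 4) g * #(G.reducedClosedWalks g v) +
      treeWalkCount dv dc (g + 4) (g + 2) * #(G.reducedClosedWalks (g + 2) v) +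
      #(G.reducedClosedWalks (g + 4) v) - #(G.cyclesAt (g + 4) v) := by
  -- The bound `6 ≤ g` is what puts `g + 4` below twice the girth.
  have hlt : ((g + 4 : ℕ) : ℕ∞) < 2 * G.egirth := by
    rw [hgirth]
    exact_mod_cast (by omega : g + 4 < 2 * g)
  have h1 : {p ∈ G.finsetWalkLength (g + 4) v v | p.IsClosedWalkWithCycle} =
      {p ∈ G.finsetWalkLength (g + 4) v v | ¬ p.reduce.Nil} \ G.cyclesAt (g + 4) v := by
    ext p
    simp only [mem_filter, mem_sdiff, mem_cyclesAt, mem_finsetWalkLength_iff]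
    by_cases hp : p.length = g + 4
    · rw [Walk.IsClosedWalkWithCycle, Walk.isAcyclic_fromEdgeSet_edgeSet_iff (by rwa [hp])]
      tauto
    · tauto
  have h2 : G.cyclesAt (g + 4) v ⊆ {p ∈ G.finsetWalkLength (g + 4) v v | ¬ p.reduce.Nil} := by
    intro p hp
    rw [mem_cyclesAt] at hp
    rw [mem_filter, mem_finsetWalkLength_iff, hp.2.isReduced.reduce_eq]
    exact ⟨hp.1, hp.2.not_nil⟩
  -- A nontrivial reduction has length at least `g` and at most `g + 4`, and even length because the
  -- graph is bipartite.
  have h3 : #{p ∈ G.finsetWalkLength (g + 4) v v | ¬ p.reduce.Nil} =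
      ∑ l ∈ {g, g + 2, g + 4}, #{p ∈ G.finsetWalkLength (g + 4) v v | p.reduce.length = l} := by
    rw [card_eq_sum_card_fiberwise (f := fun p => p.reduce.length) (t := {g, g + 2, g + 4})]
    · refine sum_congr rfl fun l hl => ?_
      rw [filter_filter]
      congr 1
      refine filter_congr fun p _ => ⟨fun h => h.2, fun h => ⟨fun H => ?_, h⟩⟩
      rw [← Walk.length_eq_zero_iff, h] at H
      simp only [mem_insert, mem_singleton] at hl
      omega
    · intro p hp
      simp only [coe_filter, Set.mem_ofPred_eq, mem_finsetWalkLength_iff] at hp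
      have hle := p.length_reduce_le
      have hge := p.isReduced_reduce.egirth_le_length hp.2
      rw [hgirth, Nat.cast_le] at hge
      obtain ⟨a, ha⟩ := hG.even_length p.reduce
      obtain ⟨b, hb⟩ := heven
      simp only [coe_insert, coe_singleton, Set.mem_insert_iff, Set.mem_singleton_iff]
      omega
  rw [h1, cast_card_sdiff h2, h3, sum_insert (by simp), sum_insert (by simp), sum_singleton]
  push_cast
  rw [hG.card_length_reduce_eq _ _ hv, hG.card_length_reduce_eq _ _ hv,
    hG.card_length_reduce_eq _ _ hv, treeWalkCount_self]
  ring

open scoped Classical in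
/-- The number of closed walks with cycle of length `g + 4` that start in `U`. -/
lemma IsBiregularWith.sum_card_isClosedWalkWithCycle {U W : Set V} {dv dc k : ℕ}
    (hG : G.IsBiregularWith U W dv dc) (hgirth : G.egirth = (2 * k : ℕ)) (hk : 3 ≤ k) :
    (∑ v with v ∈ U, #{p ∈ G.finsetWalkLength (2 * k + 4) v v | p.IsClosedWalkWithCycle} : ℚ) =
      (treeWalkCount dv dc (2 * k + 4) (2 * k)
        + treeWalkCount dv dc (2 * k + 4) (2 * k + 2) * (dc - 2)
        + (dc - 1) * (dv - 2)) * (2 * k * G.numCycles (2 * k))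
      + (treeWalkCount dv dc (2 * k + 4) (2 * k + 2) + dc - 2) *
        ((2 * k + 2) * G.numCycles (2 * k + 2)) := by
  have hlt : ∀ n, n < 4 * k → ((n : ℕ) : ℕ∞) < 2 * G.egirth := by
    intro n hn
    rw [hgirth]
    exact_mod_cast (by omega : n < 2 * (2 * k))
  have hstep : ∀ {U W : Set V} {dv dc : ℕ}, G.IsBiregularWith U W dv dc → ∀ n, 1 ≤ n →
      n + 2 < 4 * k → (G.numReducedClosedFrom U (n + 2) : ℚ) = (n + 2) * G.numCycles (n + 2) +
        ((dc - 1) * G.numReducedClosedFrom W n - n * G.numCycles n) := by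
    intro U W dv dc hG n hn h
    obtain ⟨l, rfl⟩ := Nat.exists_eq_add_of_le' hn
    have := hG.numReducedClosedFrom_add_three l (hlt _ (by omega))
    rw [hG.numCyclesFrom_eq, hG.symm.numCyclesFrom_eq] at this
    rw [show l + 1 + 2 = l + 3 by ring, this]
    push_cast
    ring
  have hzero : ∀ (U : Set V) n, 0 < n → n < 2 * k → G.numReducedClosedFrom U n = 0 :=
    fun U n h0 hn => numReducedClosedFrom_eq_zero U h0 (by rw [hgirth]; exact_mod_cast hn)
  have hbase : ∀ {U W : Set V} {dv dc : ℕ}, G.IsBiregularWith U W dv dc →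
      (G.numReducedClosedFrom U (2 * k) : ℚ) = 2 * k * G.numCycles (2 * k) := by
    intro U W dv dc hG
    -- The recursion is started one step below the girth, at `n = g - 2`, where there are neither
    -- reduced closed walks nor cycles.
    obtain ⟨n, hn⟩ : ∃ n, 2 * k = n + 2 := ⟨2 * k - 2, by omega⟩
    have hc := hG.numCyclesFrom_eq n
    have hle : G.numCyclesFrom U n ≤ G.numReducedClosedFrom U n := by
      refine sum_le_sum fun v _ => card_le_card fun p hp => ?_
      rw [mem_cyclesAt] at hp
      exact mem_reducedClosedWalks.2 ⟨hp.1, hp.2.isReduced⟩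
    rw [hzero U n (by omega) (by omega), hc] at hle
    have h0 : (n : ℚ) * G.numCycles n = 0 := by exact_mod_cast Nat.le_zero.1 hle
    have := hstep hG n (by omega) (by omega)
    rw [hzero W n (by omega) (by omega), h0, ← hn] at this
    rw [this]
    have : (2 * k : ℚ) = n + 2 := by exact_mod_cast hn
    rw [this]
    simp
  have heven : Even (2 * k) := even_two_mul k
  rw [sum_congr rfl fun v hv => hG.card_isClosedWalkWithCycle hgirth (by omega) heven
    (by simpa using hv)]
  rw [sum_sub_distrib, sum_add_distrib, sum_add_distrib, ← mul_sum, ← mul_sum]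
  have hT : ∀ n, ∑ v with v ∈ U, (#(G.reducedClosedWalks n v) : ℚ) = G.numReducedClosedFrom U n := by
    intro n
    rw [numReducedClosedFrom]
    push_cast
    rfl
  have hQ : ∑ v with v ∈ U, (#(G.cyclesAt (2 * k + 4) v) : ℚ) =
      (2 * k + 4) * G.numCycles (2 * k + 4) := by
    have := hG.numCyclesFrom_eq (2 * k + 4)
    rw [numCyclesFrom] at this
    exact_mod_cast this
  rw [hT, hT, hT, hQ, hbase hG, hstep hG (2 * k) (by omega) (by omega),
    hstep hG (2 * k + 2) (by omega) (by omega), hstep hG.symm (2 * k) (by omega) (by omega),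
    hbase hG, hbase hG.symm]
  push_cast
  ring

end SimpleGraph

/-- The girth `g` is finite, so `G` has a cycle; it is even because `G` is bipartite, so the
natural-number quotient `g / 2` inside the binomial coefficient is exact. -/
theorem theorem3 {V : Type*} [Fintype V] (G : SimpleGraph V) [DecidableRel G.Adj]
    (U W : Set V) (dv dc g : ℕ) (hG : G.IsBiregularWith U W dv dc)
    (hgirth : G.egirth = (g : ℕ∞)) (hg : 6 ≤ g) :
    (G.numClosedWalksWithCycle (g + 4) : ℚ) / (2 * ((g : ℚ) + 4)) =
      (G.numCycles (g + 2) : ℚ) * (((g : ℚ) + 2) / 2 * ((dv : ℚ) + dc) - ((g : ℚ) + 2))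
      + (G.numCycles g : ℚ) *
          ((g : ℚ) / 2 * ((dv : ℚ) - 2) * ((dc : ℚ) - 1)
            + (g : ℚ) / 2 * ((dc : ℚ) - 2) * ((dv : ℚ) - 1))
      + (G.numCycles g : ℚ) *
          ((((g / 2).choose 2 : ℚ) + (g : ℚ) / 2) * ((dv : ℚ) - 2) ^ 2
            + (((g / 2).choose 2 : ℚ) + (g : ℚ) / 2) * ((dc : ℚ) - 2) ^ 2
            + ((g : ℚ) / 2) ^ 2 * ((dv : ℚ) - 2) * ((dc : ℚ) - 2))
      + (G.numCycles g : ℚ) *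
          ((g.choose 2 : ℚ) + 2 * (g : ℚ)
            + ((g : ℚ) + 2) * ((g : ℚ) / 2 * ((dv : ℚ) - 2) + (g : ℚ) / 2 * ((dc : ℚ) - 2))) := by
  classical
  have hacyc : ¬ G.IsAcyclic := fun h => by
    rw [h.egirth_eq_top] at hgirth
    exact ENat.top_ne_natCast g hgirth
  obtain ⟨k, rfl⟩ : ∃ k, g = 2 * k := by
    obtain ⟨v, c, -, hc⟩ := SimpleGraph.exists_egirth_eq_length.2 hacyc
    rw [hgirth, Nat.cast_inj] at hc
    obtain ⟨k, hk⟩ := hG.even_length c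
    exact ⟨k, by omega⟩
  -- Starts in `U` and in `W` are counted by the same lemma with the two degrees exchanged.
  have hsum : (G.numClosedWalksWithCycle (2 * k + 4) : ℚ) =
      (∑ v with v ∈ U, (Finset.card
        {p ∈ G.finsetWalkLength (2 * k + 4) v v | p.IsClosedWalkWithCycle} : ℚ)) +
      ∑ v with v ∈ W, (Finset.card
        {p ∈ G.finsetWalkLength (2 * k + 4) v v | p.IsClosedWalkWithCycle} : ℚ) := by
    rw [SimpleGraph.numClosedWalksWithCycle_eq_sum, Nat.cast_sum,
      ← Finset.sum_filter_add_sum_filter_not Finset.univ (· ∈ U)]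
    simp only [hG.mem_right_iff]
  have h2 : ∀ a b : ℚ, SimpleGraph.treeWalkCount a b (2 * k + 4) (2 * k + 2) =
      a + (k + 1) * (a + b - 2) := by
    intro a b
    have := SimpleGraph.treeWalkCount_add_two (k + 1) a b
    push_cast at this
    exact this
  rw [hsum, hG.sum_card_isClosedWalkWithCycle hgirth (by omega),
    hG.symm.sum_card_isClosedWalkWithCycle hgirth (by omega), h2, h2,
    SimpleGraph.treeWalkCount_add_four, SimpleGraph.treeWalkCount_add_four,
    Nat.mul_div_cancel_left k two_pos, Nat.cast_choose_two, Nat.cast_choose_two]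
  push_cast
  have : (2 * (2 * (k : ℚ) + 4)) ≠ 0 := by positivity
  rw [div_eq_iff this]
  ring
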